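/- Let $G$ be a finite group and let $\Sigma=(V,E,F)$ be a 2-dimensional CW complex with finite vertex set $V$, finite set $E$ of oriented edges and 2-cells $F$, each 2-cell $f$ being attached along a closed edge path $\partial f$; let $Y\subseteq V$ be a (possibly empty) set of "ghost vertices". The quantum double code of $(\Sigma,Y)$ is the subspace $\mathcal C\subseteq\mathbb C[G^{E}]$ of all states fixed by (i) the $X$-checks $X_v^h$, $v\in V\setminus Y$, $h\in G$, where $X_v^h$ multiplies $g_e$ by $h$ from the left for every edge $e$ leaving $v$ and by $h^{-1}$ from the right for every edge $e$ entering $v$, and (ii) the $Z$-checks $|\mathbf g\rangle\mapsto\mathbb I(\mathbf g_{\partial f}=1)|\mathbf g\rangle$, $f\in F$, where $\mathbf g_{\gamma}=g_{e_1}^{\pm1}\cdots g_{e_m}^{\pm1}$ is the holonomy along an edge path $\gamma$. Let $\Sigma/Y$ be $\Sigma$ with all vertices of $Y$ identified to one vertex ($\Sigma/\emptyset=\Sigma$). A loop is a closed edge path; it is non-contractible if it is not null-homotopic in the topological space in question, and its length is its number of edges. A $Z$-type operator is $|\mathbf g\rangle\mapsto \mathbb I(g_{q_1}^{a_1}\cdots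 g_{q_j}^{a_j}\in K)|\mathbf g\rangle$ with $K\le G$, $q_i\in E$, $a_i\in\{\pm1\}$; it acts on the qudits $q_1,\dots,q_j$ (counted without repetition). An operator $O$ satisfies the Knill--Laflamme condition if there is $c\in\mathbb C$ with $\langle\psi|O|\varphi\rangle=c\langle\psi|\varphi\rangle$ for all $\psi,\varphi\in\mathcal C$. A $Z$-logical operator is a $Z$-type operator that preserves $\mathcal C$ and violates this condition, and a loop supports it if it acts only on edges of the loop. The distance $d_Z$ is the least number of qudits on which a $Z$-type operator violating the condition acts ($\infty$ if there is none). (1) For every such $(\Sigma,Y)$ there is a finite 2-dimensional CW complex $\Sigma'$ with the same set $E$ of edges, and a set $Y'$ of ghost vertices of $\Sigma'$ (empty if $Y$ is empty), such that the quantum double codes of $(\Sigma,Y)$ and $(\Sigma',Y')$ are the same subspace of $\mathbb C[G^E]$, and every non-contractible loop $\gamma$ in $\Sigma'/Y'$ supports a $Z$-logical operator; in fact $|\mathbf g\rangle\mapsto\mathbb I(\mathbf g_\gamma=1)|\mathbf g\rangle$ is one. (2) If every non-contractible loop in $\Sigma/Y$ supports a $Z$-logical operator of the quantum double code of $(\Sigma,Y)$,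 then $d_Z$ equals the length of the shortest non-contractible loop in $\Sigma/Y$ (both being $\infty$ if there is no such loop). -/

import Mathlib

universe u v w z

namespace QDouble

/-! ### Group qudit codes -/

section Codes

variable {E : Type v} {G : Type w} [Group G]

/-- A word in qudits with orientations: `(q, true)` stands for `g_q` and `(q, false)` for its
inverse. Qudits may be repeated. -/
abbrev Word (E : Type v) := List (E × Bool)

/-- The value `g_{q₁}^{a₁} ⋯ g_{q_j}^{a_j}` of a word at a configuration `g`. -/
def Word.eval (x : Word E) (g : E → G) : G :=
  (x.map fun p => if p.2 then g p.1 else (g p.1)⁻¹).prod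

/-- The set of qudits that occur in a word. -/
def Word.qudits [DecidableEq E] (x : Word E) : Finset E :=
  (x.map Prod.fst).toFinset

/-- The physical space `ℂ[G^E]`, one `G`-qudit for each element of `E`; the basis vector `|g⟩` is
the indicator function of `g`. -/
abbrev Phys (E : Type v) (G : Type w) := (E → G) → ℂ

/-- The `Z`-type operator `|g⟩ ↦ 𝕀(g_{q₁}^{a₁} ⋯ g_{q_j}^{a_j} ∈ K) |g⟩`. -/
noncomputable def zOp (x : Word E) (K : Subgroup G) : Phys E G →ₗ[ℂ] Phys E G where
  toFun ψ := Set.indicator {g | x.eval g ∈ K} ψ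
  map_add' ψ φ := Set.indicator_add _ ψ φ
  map_smul' c ψ := Set.indicator_const_smul _ c ψ

/-- The `X`-type operator `|g⟩ ↦ |k g h⁻¹⟩`. -/
def xOp (k h : E → G) : Phys E G →ₗ[ℂ] Phys E G :=
  LinearMap.funLeft ℂ ℂ fun g => k⁻¹ * g * h

/-- The code space of a group CSS code: the joint `+1`-eigenspace of a set of `X`-checks and a set
of `Z`-checks. -/
def codeSpace (SX : Set ((E → G) × (E → G))) (SZ : Set (Word E × Subgroup G)) :
    Submodule ℂ (Phys E G) where
  carrier := {ψ | (∀ s ∈ SX, xOp s.1 s.2 ψ = ψ) ∧ ∀ s ∈ SZ, zOp s.1 s.2 ψ = ψ}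
  add_mem' := fun ha hb =>
    ⟨fun s hs => by rw [map_add, ha.1 s hs, hb.1 s hs],
      fun s hs => by rw [map_add, ha.2 s hs, hb.2 s hs]⟩
  zero_mem' := ⟨fun _ _ => map_zero _, fun _ _ => map_zero _⟩
  smul_mem' := fun c _ ha =>
    ⟨fun s hs => by rw [map_smul, ha.1 s hs], fun s hs => by rw [map_smul, ha.2 s hs]⟩

variable [Fintype E] [DecidableEq E] [Fintype G]

/-- The Knill-Laflamme condition `⟨ψ_α| O |ψ_β⟩ = c δ_{αβ}` for an operator `O` on a code,
in the basis-free form `⟨ψ| O |φ⟩ = c ⟨ψ|φ⟩` for all code states `ψ`, `φ`. -/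
def KnillLaflamme (C : Submodule ℂ (Phys E G)) (O : Phys E G →ₗ[ℂ] Phys E G) : Prop :=
  ∃ c : ℂ, ∀ ψ ∈ C, ∀ φ ∈ C, star ψ ⬝ᵥ O φ = c * (star ψ ⬝ᵥ φ)

/-- A `Z`-type operator is a (nontrivial) `Z`-logical operator of the code `C` if it preserves `C`
and violates the Knill-Laflamme condition. -/
def IsZLogical (C : Submodule ℂ (Phys E G)) (x : Word E) (K : Subgroup G) : Prop :=
  (∀ ψ ∈ C, zOp x K ψ ∈ C) ∧ ¬ KnillLaflamme C (zOp x K)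

/-- The `Z`-distance: the least number of qudits on which a `Z`-type operator that violates the
Knill-Laflamme condition acts (`⊤` if there is no such operator). -/
noncomputable def dZ (C : Submodule ℂ (Phys E G)) : ℕ∞ :=
  ⨅ (x : Word E) (K : Subgroup G) (_ : ¬ KnillLaflamme C (zOp x K)), (x.qudits.card : ℕ∞)

end Codes

/-! ### Two-dimensional CW complexes -/

/-- A graph with oriented edges; loops and multiple edges are allowed. -/
structure DirGraph (V : Type u) (E : Type v) where
  src : E → V
  tgt : E → V

namespace DirGraph

variable {V : Type u} {E : Type v}

/-- Edge paths, which may traverse every edge in either direction. -/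
inductive Walk (Γ : DirGraph V E) : V → V → Type (max u v)
  | nil (a : V) : Walk Γ a a
  | fwd (e : E) {b : V} (p : Walk Γ (Γ.tgt e) b) : Walk Γ (Γ.src e) b
  | bwd (e : E) {b : V} (p : Walk Γ (Γ.src e) b) : Walk Γ (Γ.tgt e) b

variable (Γ : DirGraph V E)

/-- The oriented edges that an edge path traverses, in order. -/
def Walk.word {Γ : DirGraph V E} : {a b : V} → Γ.Walk a b → Word E
  | _, _, .nil _ => []
  | _, _, .fwd e p => (e, true) :: p.word
  | _, _, .bwd e p => (e, false) :: p.word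

/-- The length of an edge path: its number of edges, counted with multiplicity. -/
def Walk.length {Γ : DirGraph V E} {a b : V} (p : Γ.Walk a b) : ℕ := p.word.length

/-- The graph obtained by applying a map to the vertices. -/
def mapVert {V' : Type u} (π : V → V') : DirGraph V' E where
  src e := π (Γ.src e)
  tgt e := π (Γ.tgt e)

/-- The image of an edge path under a map of the vertices. -/
def Walk.mapVert {Γ : DirGraph V E} {V' : Type u} (π : V → V') :
    {a b : V} → Γ.Walk a b → (Γ.mapVert π).Walk (π a) (π b)
  | _, _, .nil a => .nil (π a)
  | _, _, .fwd e p => .fwd (Γ := Γ.mapVert π) e (p.mapVert π)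
  | _, _, .bwd e p => .bwd (Γ := Γ.mapVert π) e (p.mapVert π)

/-- The gluing of the two ends of every edge `{e} × [0,1]` to the vertices. -/
inductive Glue : V ⊕ (Σ _ : E, unitInterval) → V ⊕ (Σ _ : E, unitInterval) → Prop
  | src (e : E) : Glue (.inr ⟨e, 0⟩) (.inl (Γ.src e))
  | tgt (e : E) : Glue (.inr ⟨e, 1⟩) (.inl (Γ.tgt e))

/-- The topological space of a graph: vertices and unit intervals, glued. -/
def Space : Type (max u v) := Quot Γ.Glue

/-- The quotient topology, with the vertices discrete. -/
instance : TopologicalSpace Γ.Space :=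
  letI : TopologicalSpace V := ⊥
  inferInstanceAs (TopologicalSpace (Quot Γ.Glue))

/-- A vertex as a point of the space of the graph. -/
def pt (a : V) : Γ.Space := Quot.mk _ (.inl a)

/-- The path that runs along an edge. -/
def edgePath (e : E) : Path (Γ.pt (Γ.src e)) (Γ.pt (Γ.tgt e)) where
  toFun t := Quot.mk _ (.inr ⟨e, t⟩)
  continuous_toFun :=
    letI : TopologicalSpace V := ⊥
    continuous_quot_mk.comp (continuous_inr.comp continuous_sigmaMk)
  source' := Quot.sound (Glue.src e)
  target' := Quot.sound (Glue.tgt e)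

/-- The continuous path along an edge path. -/
noncomputable def Walk.toPath {Γ : DirGraph V E} :
    {a b : V} → Γ.Walk a b → Path (Γ.pt a) (Γ.pt b)
  | _, _, .nil a => Path.refl (Γ.pt a)
  | _, _, .fwd e p => (Γ.edgePath e).trans p.toPath
  | _, _, .bwd e p => (Γ.edgePath e).symm.trans p.toPath

end DirGraph

/-- A 2-dimensional CW complex with vertices `V`, oriented edges `E` and 2-cells `F`, every 2-cell
being attached along a closed edge path. -/
structure TwoComplex (V : Type u) (E : Type v) (F : Type w) extends DirGraph V E where
  base : F → V
  bdry : ∀ f, toDirGraph.Walk (base f) (base f)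

namespace TwoComplex

variable {V : Type u} {E : Type v} {F : Type w} (S : TwoComplex V E F)

/-- The closed unit disk. -/
abbrev Disk : Type := Metric.closedBall (0 : ℂ) 1

/-- The point `exp (2 π i t)` on the boundary of the disk. -/
noncomputable def circlePt (t : unitInterval) : Disk :=
  ⟨Circle.exp (2 * Real.pi * t), by rw [mem_closedBall_zero_iff, Circle.norm_coe]⟩

/-- The gluing of the boundary of every 2-cell to the graph along its attaching path. -/
inductive Glue₂ :
    S.toDirGraph.Space ⊕ (Σ _ : F, Disk) → S.toDirGraph.Space ⊕ (Σ _ : F, Disk) → Prop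
  | attach (f : F) (t : unitInterval) :
      Glue₂ (.inr ⟨f, circlePt t⟩) (.inl ((S.bdry f).toPath t))

/-- The topological space of a 2-complex: its graph with a disk glued in for every 2-cell. -/
def Space : Type (max u v w) := Quot S.Glue₂

instance : TopologicalSpace S.Space :=
  inferInstanceAs (TopologicalSpace (Quot S.Glue₂))

/-- The inclusion of the 1-skeleton. -/
def incl (x : S.toDirGraph.Space) : S.Space := Quot.mk _ (.inl x)

theorem continuous_incl : Continuous S.incl := continuous_quot_mk.comp continuous_inl

/-- A closed edge path is non-contractible if it is not null-homotopic in the space of the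
2-complex. -/
def NonContractible {a : V} (γ : S.toDirGraph.Walk a a) : Prop :=
  ¬ (γ.toPath.map S.continuous_incl).Homotopic (Path.refl (S.incl (S.toDirGraph.pt a)))

/-- The length of the shortest non-contractible closed edge path (`⊤` if there is none). -/
noncomputable def systole : ℕ∞ :=
  ⨅ (a : V) (γ : S.toDirGraph.Walk a a) (_ : S.NonContractible γ), (γ.length : ℕ∞)

/-- The complex `Σ/Y` in which all vertices in `Y` are identified to a single one (it has the same
vertices as `Σ` if `Y` is empty). -/
def collapse (Y : Set V) : TwoComplex (Quot fun a b : V => a ∈ Y ∧ b ∈ Y) E F where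
  toDirGraph := S.toDirGraph.mapVert (Quot.mk _)
  base f := Quot.mk _ (S.base f)
  bdry f := (S.bdry f).mapVert (Quot.mk _)

open Classical in
/-- The `X`-check of a vertex `a` and `g : G`: left multiplication by `g` on the edges that leave
`a`, right multiplication by `g⁻¹` on the edges that enter `a` (a loop at `a` gets both). -/
noncomputable def vertexCheck {G : Type z} [Group G] (a : V) (g : G) : (E → G) × (E → G) :=
  (fun e => if S.src e = a then g else 1, fun e => if S.tgt e = a then g else 1)

variable (G : Type z) [Group G]

/-- The code space of the quantum double code with gauge group `G` on the complex with ghost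
vertices `Y`: `X`-checks at all vertices outside `Y`, and for every 2-cell the `Z`-check that the
holonomy around its boundary is trivial. The code is smooth if `Y` is empty, and rough otherwise. -/
noncomputable def doubleCode (Y : Set V) : Submodule ℂ (Phys E G) :=
  codeSpace {s | ∃ a, a ∉ Y ∧ ∃ g : G, s = S.vertexCheck a g}
    {s | ∃ f : F, s = ((S.bdry f).word, ⊥)}

/-- A closed edge path of `Σ/Y` supports a `Z`-logical operator: there is a `Z`-logical operator of
the quantum double code that acts only on qudits on the path. -/
def SupportsZLogical [Fintype E] [DecidableEq E] [Fintype G] (Y : Set V)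
    {a : Quot fun a b : V => a ∈ Y ∧ b ∈ Y} (γ : (S.collapse Y).toDirGraph.Walk a a) : Prop :=
  ∃ (x : Word E) (K : Subgroup G),
    x.qudits ⊆ γ.word.qudits ∧ IsZLogical (S.doubleCode G Y) x K

end TwoComplex

end QDouble

/-! By `mem_doubleCode_iff`, code states are the functions supported on flat configurations and
invariant under gauge transformations trivial on `Y`; such transformations are gauge transformations
of `Σ/Y` trivial at the collapsed vertex. The proof compares two properties of a loop in `Σ/Y`:
being null-homotopic, and having trivial holonomy for every flat configuration.

The first implies the second (`eval_eq_one_of_not_nonContractible`). A flat `g` defines a map from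
the complex to `X/G`, where `X` is a contractible space with a free `G`-action: edge `e` goes to the
image of a path from `x` to `g e • x`, and the map extends over each 2-cell because its boundary
lifts to a closed path. Path lifting in the covering `X → X/G` reads off the holonomy, which is
therefore a homotopy invariant.

Distance: if an operator acts on a set `A` of fewer qudits than the systole, all closed edge paths
of length at most `|A|` have trivial holonomy, so every flat configuration is gauge equivalent to
one that is trivial on `A` (`exists_gauge_eq_one`). Averaging over gauge transformations then yields
the Knill-Laflamme condition (`knillLaflamme_of_exists_gauge`). The opposite inequality is the
hypothesis that loops support logical operators.

Saturation: the second property need not imply the first, since `G` may fail to detect elements of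
the fundamental group. Keep the graph of `Σ/Y` and replace the 2-cells by finitely many that make
two edge paths with common ends homotopic as soon as their holonomies agree for all flat
configurations (`not_nonContractible_of_eval_eq_one`). The flat configurations, and so the code, do
not change. A loop that is still non-contractible then has nontrivial holonomy for some flat
configuration, so its check separates two nonzero code states (`isZLogical_of_eval_ne_one`). -/

namespace QDouble

open unitInterval MeasureTheory Topology

/-! ### A contractible space with a free action -/

/-- The functions from the unit interval to `G`, with the distance between two functions being the
outer measure of the set on which they differ. -/
def StepSpace (G : Type z) : Type z := I → G

namespace StepSpace

variable {G : Type z}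

/-- Outer measure is monotone and subadditive on arbitrary sets, so no measurability of the
functions is required. -/
noncomputable instance : PseudoMetricSpace (StepSpace G) where
  dist f f' := (volume : Measure I).real {t | f t ≠ f' t}
  dist_self f := by simp
  dist_comm f f' := by simp only [ne_comm]
  dist_triangle f f' f'' :=
    (measureReal_mono fun t ht => by
      by_contra h
      simp only [Set.mem_union, Set.mem_ofPred_eq, not_or, not_not] at h
      exact ht (h.1.trans h.2)).trans (measureReal_union_le _ _)

theorem dist_def (f f' : StepSpace G) :
    dist f f' = (volume : Measure I).real {t | f t ≠ f' t} := rfl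

theorem measureReal_uIcc (s s' : I) : (volume : Measure I).real (Set.uIcc s s') = dist s s' := by
  rw [measureReal_def, unitInterval.volume_uIcc, edist_dist, ENNReal.toReal_ofReal dist_nonneg,
    dist_comm]

variable [Group G]

instance : MulAction G (StepSpace G) where
  smul g f := fun t => g * f t
  one_smul f := funext fun t => one_mul (f t)
  mul_smul g h f := funext fun t => mul_assoc g h (f t)

theorem smul_apply (g : G) (f : StepSpace G) (t : I) : (g • f) t = g * f t := rfl

instance : ContinuousConstSMul G (StepSpace G) where
  continuous_const_smul g := (Isometry.of_dist_eq fun f f' => by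
    simp only [dist_def, smul_apply, ne_eq, mul_right_inj]).continuous

theorem dist_smul {g : G} (hg : g ≠ 1) (f : StepSpace G) : dist (g • f) f = 1 := by
  have : {t | (g • f) t ≠ f t} = Set.univ := by
    ext t
    simp [smul_apply, hg]
  rw [dist_def, this, probReal_univ]

theorem eq_one_of_smul_eq {g : G} {f : StepSpace G} (h : g • f = f) : g = 1 := by
  by_contra hg
  have := dist_smul hg f
  rw [h, dist_self] at this
  exact zero_ne_one this

/-- The quotient of the space by the action of `G`. -/
def proj : StepSpace G → Quotient (MulAction.orbitRel G (StepSpace G)) := Quotient.mk _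

theorem isQuotientCoveringMap_proj : IsQuotientCoveringMap (proj (G := G)) G where
  toIsQuotientMap := isQuotientMap_quotient_mk'
  toContinuousConstSMul := inferInstance
  apply_eq_iff_mem_orbit := Quotient.eq.trans MulAction.orbitRel_apply
  disjoint f := by
    -- A nontrivial translate moves every point by exactly 1, which is impossible inside a ball of
    -- diameter at most 1 with strict inequalities.
    refine ⟨Metric.ball f (1 / 2), Metric.ball_mem_nhds _ (by norm_num), ?_⟩
    rintro g ⟨_, ⟨f', hf', rfl⟩, hf''⟩
    by_contra hg
    have h1 := dist_smul hg f'
    have h2 := dist_triangle_right (g • f') f' f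
    rw [Metric.mem_ball] at hf' hf''
    linarith

/-- The contraction, which makes a function constant on a growing interval. -/
noncomputable def contract (s : I) (f : StepSpace G) : StepSpace G :=
  -- The clause `s = 1` recovers `f` at the endpoint `t = 1` as well, so that the homotopy ends
  -- exactly at the identity.
  open Classical in fun t => if t < s ∨ s = 1 then f t else 1

/-- Two contracted functions can differ only where `f` and `f'` differ or between `s` and `s'`. This
gives joint continuity of the contraction. -/
theorem dist_contract_le (s s' : I) (f f' : StepSpace G) :
    dist (contract s f) (contract s' f') ≤ dist f f' + dist s s' := by
  rw [← measureReal_uIcc, dist_def, dist_def]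
  refine (measureReal_mono fun t ht => ?_).trans (measureReal_union_le _ _)
  by_contra h
  simp only [Set.mem_union, Set.mem_ofPred_eq, not_or, not_not, Set.mem_uIcc, not_and, not_le] at h
  refine ht ?_
  obtain ⟨h, h1, h2⟩ := h
  unfold contract
  rcases lt_or_ge t s with hs | hs
  · have : t < s' := by
      by_contra hs'
      exact (h2 (not_lt.1 hs')).not_ge hs.le
    simp only [hs, this, true_or, if_true, h]
  · have hs' := h1 hs
    have hst : s < t := by
      refine lt_of_le_of_ne hs ?_
      rintro rfl
      exact (h2 hs'.le).ne rfl
    have e1 : s ≠ 1 := (hst.trans_le le_one').ne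
    have e2 : s' ≠ 1 := (hs'.trans_le le_one').ne
    simp only [hst.not_gt, hs'.not_gt, e1, e2, or_self, if_false]

theorem continuous_contract : Continuous fun x : I × StepSpace G => contract x.1 x.2 := by
  refine Metric.continuous_iff.2 fun x ε hε => ⟨ε / 2, by positivity, fun y hy => ?_⟩
  have h := dist_contract_le y.1 x.1 y.2 x.2
  have h1 : dist y.1 x.1 ≤ dist y x := le_max_left _ _
  have h2 : dist y.2 x.2 ≤ dist y x := le_max_right _ _
  linarith

instance : ContractibleSpace (StepSpace G) := by
  refine (contractible_iff_id_nullhomotopic _).2 ⟨fun _ => 1, ⟨ContinuousMap.Homotopy.symm ?_⟩⟩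
  exact
    { toFun := fun x => contract x.1 x.2
      continuous_toFun := continuous_contract
      map_zero_left := fun f => by
        funext t
        simp only [contract, not_lt_zero, zero_ne_one, or_self, if_false]
        rfl
      map_one_left := fun f => by
        funext t
        simp [contract] }

end StepSpace

/-! ### Maps on the disk -/

namespace TwoComplex

theorem continuous_circlePt : Continuous circlePt :=
  Continuous.subtype_mk (by fun_prop) _

theorem circlePt_zero_eq_one : circlePt 0 = circlePt 1 := by
  ext1
  simp [circlePt]

theorem eq_or_of_circlePt_eq {t t' : I} (h : circlePt t = circlePt t') :
    t = t' ∨ (t = 0 ∧ t' = 1) ∨ (t = 1 ∧ t' = 0) := by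
  have h1 : Circle.exp (2 * Real.pi * t) = Circle.exp (2 * Real.pi * t') :=
    Circle.ext (congrArg (fun z : Disk => (z : ℂ)) h)
  obtain ⟨m, hm⟩ := Circle.exp_eq_exp.1 h1
  have h2 : (t : ℝ) = t' + m := by
    have := Real.pi_pos
    have h3 : 2 * Real.pi * ((t : ℝ) - (t' + m)) = 0 := by linear_combination hm
    rcases mul_eq_zero.1 h3 with h3 | h3
    · linarith
    · linarith
  have ht := t.2
  have ht' := t'.2
  have hm1 : (m : ℝ) ≤ 1 := by linarith [ht.2, ht'.1]
  have hm2 : (-1 : ℝ) ≤ m := by linarith [ht.1, ht'.2]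
  have hm1' : m ≤ 1 := by exact_mod_cast hm1
  have hm2' : -1 ≤ m := by exact_mod_cast hm2
  obtain rfl | rfl | rfl : m = -1 ∨ m = 0 ∨ m = 1 := by omega
  · refine Or.inr (Or.inl ⟨Subtype.ext ?_, Subtype.ext ?_⟩) <;>
    · push_cast at *
      linarith [ht.1, ht'.2]
  · exact Or.inl (Subtype.ext (by simpa using h2))
  · refine Or.inr (Or.inr ⟨Subtype.ext ?_, Subtype.ext ?_⟩) <;>
    · push_cast at *
      linarith [ht.2, ht'.1]

/-- Polar coordinates on the disk. -/
noncomputable def polar (x : I × I) : Disk :=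
  -- The radius is `1 - x.1`: time 0 of a contraction lies on the boundary circle, time 1 at the
  -- centre.
  ⟨(1 - (x.1 : ℝ)) • (circlePt x.2 : ℂ), by
    rw [mem_closedBall_zero_iff, norm_smul, circlePt, Circle.norm_coe, mul_one, Real.norm_eq_abs,
      abs_of_nonneg (sub_nonneg.2 x.1.2.2)]
    linarith [x.1.2.1]⟩

theorem continuous_polar : Continuous polar := by
  have := continuous_circlePt
  exact Continuous.subtype_mk (by fun_prop) _

theorem polar_surjective : Function.Surjective polar := by
  rintro ⟨z, hz⟩
  rw [mem_closedBall_zero_iff] at hz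
  obtain ⟨t, ht⟩ : ∃ t : I, (Circle.exp (2 * Real.pi * t) : ℂ) = Complex.exp (z.arg * Complex.I) := by
    have hp := Real.pi_pos
    have h1 := Complex.neg_pi_lt_arg z
    have h2 := Complex.arg_le_pi z
    rcases le_or_gt 0 z.arg with h | h
    · refine ⟨⟨z.arg / (2 * Real.pi), by positivity, ?_⟩, ?_⟩
      · rw [div_le_one (by positivity)]
        linarith
      · rw [Circle.coe_exp]
        congr 3
        field_simp
    · refine ⟨⟨(z.arg + 2 * Real.pi) / (2 * Real.pi), ?_, ?_⟩, ?_⟩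
      · apply div_nonneg <;> linarith
      · rw [div_le_one (by positivity)]
        linarith
      · rw [mul_div_cancel₀ _ (by positivity), Circle.exp_add, Circle.exp_two_pi, mul_one,
          Circle.coe_exp]
  refine ⟨(⟨1 - ‖z‖, by linarith, by linarith [norm_nonneg z]⟩, t), Subtype.ext ?_⟩
  simp only [polar, circlePt, ht, sub_sub_cancel, Complex.real_smul]
  exact Complex.norm_mul_exp_arg_mul_I z

theorem polar_eq {s t s' t' : I} (h : polar (s, t) = polar (s', t')) :
    s = s' ∧ (s = 1 ∨ circlePt t = circlePt t') := by
  have h1 : (1 - (s : ℝ)) • (circlePt t : ℂ) = (1 - (s' : ℝ)) • (circlePt t' : ℂ) :=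
    congrArg Subtype.val h
  have h2 : (s : ℝ) = s' := by
    have h3 := congrArg norm h1
    rw [norm_smul, norm_smul, circlePt, circlePt, Circle.norm_coe, Circle.norm_coe,
      Real.norm_of_nonneg (sub_nonneg.2 s.2.2), Real.norm_of_nonneg (sub_nonneg.2 s'.2.2)] at h3
    linarith
  refine ⟨Subtype.ext h2, ?_⟩
  rw [← h2] at h1
  rcases eq_or_ne (s : ℝ) 1 with h3 | h3
  · exact Or.inl (Subtype.ext h3)
  · exact Or.inr (Subtype.ext (smul_right_injective ℂ (sub_ne_zero.2 h3.symm) h1))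

/-- A loop in a contractible space extends to the disk. -/
theorem exists_disk_extension {X : Type*} [TopologicalSpace X] [ContractibleSpace X]
    (l : C(I, X)) (hl : l 0 = l 1) : ∃ d : C(Disk, X), ∀ t, d (circlePt t) = l t := by
  obtain ⟨x, ⟨H⟩⟩ := id_nullhomotopic X
  -- The square is compact and the disk Hausdorff, so maps on the square that respect the
  -- identifications of `polar` descend. The contracted loop does: at time 1 it is constant, and the
  -- loop closes up along the seam.
  have hq : IsQuotientMap polar :=
    continuous_polar.isClosedMap.isQuotientMap continuous_polar polar_surjective
  let m : C(I × I, X) := ⟨fun y => H (y.1, l y.2), by fun_prop⟩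
  have hm : Function.FactorsThrough m (⟨polar, continuous_polar⟩ : C(I × I, Disk)) := by
    rintro ⟨s, t⟩ ⟨s', t'⟩ h
    obtain ⟨rfl, rfl | hc⟩ := polar_eq (show polar (s, t) = polar (s', t') from h)
    · change H (1, l t) = H (1, l t')
      rw [H.apply_one, H.apply_one]
      rfl
    · have : l t = l t' := by
        rcases eq_or_of_circlePt_eq hc with rfl | ⟨rfl, rfl⟩ | ⟨rfl, rfl⟩
        · rfl
        · exact hl
        · exact hl.symm
      change H (s, l t) = H (s, l t')
      rw [this]
  refine ⟨IsQuotientMap.lift (f := ⟨polar, continuous_polar⟩) hq m hm, fun t => ?_⟩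
  have h0 : circlePt t = (⟨polar, continuous_polar⟩ : C(I × I, Disk)) (0, t) :=
    Subtype.ext (by simp [polar])
  rw [h0]
  refine (DFunLike.congr_fun (IsQuotientMap.lift_comp hq m hm) (0, t)).trans ?_
  exact H.apply_zero _

instance : ContractibleSpace Disk :=
  (convex_closedBall (0 : ℂ) 1).contractibleSpace ⟨0, by simp⟩

end TwoComplex

end QDouble

namespace QDouble

open unitInterval Topology

section Words

variable {E : Type v} {G : Type z} [Group G]

theorem Word.eval_nil (g : E → G) : Word.eval [] g = 1 := rfl

theorem Word.eval_cons_true (e : E) (x : Word E) (g : E → G) :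
    Word.eval ((e, true) :: x) g = g e * Word.eval x g := by
  simp [Word.eval]

theorem Word.eval_cons_false (e : E) (x : Word E) (g : E → G) :
    Word.eval ((e, false) :: x) g = (g e)⁻¹ * Word.eval x g := by
  simp [Word.eval]

end Words

/-! ### Maps out of the space of a complex -/

namespace DirGraph

variable {V : Type u} {E : Type v} (Γ : DirGraph V E)

/-- The map on the space of a graph given by images of the vertices and paths for the edges. -/
noncomputable def lift {B : Type*} [TopologicalSpace B] (b : V → B) (p : ∀ e, Path (b (Γ.src e)) (b (Γ.tgt e))) : C(Γ.Space, B) where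
  toFun := Quot.lift (Sum.elim b fun x => p x.1 x.2) fun _ _ h => by
    cases h with
    | src e => exact (p e).source
    | tgt e => exact (p e).target
  continuous_toFun := by
    let _ : TopologicalSpace V := ⊥
    have : DiscreteTopology V := ⟨rfl⟩
    exact continuous_quot_lift _ (continuous_sumElim.2
      ⟨continuous_of_discreteTopology, continuous_sigma fun e => (p e).continuous⟩)

variable {Γ}

variable {G : Type z} [Group G] {X : Type*} [TopologicalSpace X] [MulAction G X]
  [ContinuousConstSMul G X]

/-- If the image of every edge lifts along a `G`-invariant map to a path from `x` to `g e • x`, then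
the image of every edge path lifts to a path from `x` to its holonomy times `x`. -/
theorem Walk.exists_lift {B : Type*} {p : X → B} (hp : ∀ (h : G) y, p (h • y) = p y) {f : Γ.Space → B} {x : X}
    (hf : ∀ a, f (Γ.pt a) = p x) {g : E → G} (α : ∀ e, Path x (g e • x))
    (hα : ∀ e t, f (Γ.edgePath e t) = p (α e t)) {a b : V} (γ : Γ.Walk a b) :
    ∃ L : Path x (γ.word.eval g • x), ∀ t, f (γ.toPath t) = p (L t) := by
  induction γ with
  | nil a => exact ⟨(Path.refl x).cast rfl (one_smul G x), fun t => hf a⟩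
  | fwd e γ ih =>
    obtain ⟨L, hL⟩ := ih
    refine ⟨(α e).trans ((L.map (continuous_const_smul (g e))).cast rfl (by
      rw [Walk.word, Word.eval_cons_true, mul_smul])), fun t => ?_⟩
    rw [Walk.toPath, Path.trans_apply, Path.trans_apply]
    split_ifs
    · exact hα e _
    · exact (hL _).trans (hp _ _).symm
  | bwd e γ ih =>
    obtain ⟨L, hL⟩ := ih
    -- The reversed path runs from `g e • x` to `x`; its translate by `(g e)⁻¹` runs from `x` to `(g
    -- e)⁻¹ • x`, where the translated lift of the remaining path starts.
    refine ⟨(((α e).symm.map (continuous_const_smul (g e)⁻¹)).cast (inv_smul_smul _ _).symm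
      rfl).trans ((L.map (continuous_const_smul (g e)⁻¹)).cast rfl (by
      rw [Walk.word, Word.eval_cons_false, mul_smul])), fun t => ?_⟩
    rw [Walk.toPath, Path.trans_apply, Path.trans_apply]
    split_ifs
    · exact (hα e _).trans (hp _ _).symm
    · exact (hL _).trans (hp _ _).symm

end DirGraph

namespace TwoComplex

variable {V : Type u} {E : Type v} {F : Type w} (S : TwoComplex V E F)

/-- The map on the space of a 2-complex given by its restrictions to the graph and to the 2-cells. -/
noncomputable def lift {B : Type*} [TopologicalSpace B] (φ : C(S.toDirGraph.Space, B)) (d : F → C(Disk, B))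
    (h : ∀ f t, d f (circlePt t) = φ ((S.bdry f).toPath t)) : C(S.Space, B) where
  toFun := Quot.lift (Sum.elim φ fun x => d x.1 x.2) fun _ _ hr => by
    cases hr with
    | attach f t => exact h f t
  continuous_toFun := continuous_quot_lift _ (continuous_sumElim.2
    ⟨φ.continuous, continuous_sigma fun f => (d f).continuous⟩)

/-- A closed edge path that is null-homotopic has trivial holonomy for every flat configuration. -/
theorem eval_eq_one_of_not_nonContractible {G : Type z} [Group G] {g : E → G}
    (hg : ∀ f, (S.bdry f).word.eval g = 1) {a : V} {γ : S.toDirGraph.Walk a a}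
    (hγ : ¬ S.NonContractible γ) : γ.word.eval g = 1 := by
  have hq := StepSpace.isQuotientCoveringMap_proj (G := G)
  let p : C(StepSpace G, _) := ⟨StepSpace.proj, hq.continuous⟩
  have hp : ∀ (h : G) y, p (h • y) = p y := fun h y => hq.map_smul h
  let x : StepSpace G := fun _ => 1
  let α : ∀ e, Path x (g e • x) := fun e => PathConnectedSpace.somePath _ _
  let φ := S.toDirGraph.lift (fun _ => p x) fun e =>
    ((α e).map p.continuous).cast rfl (hp (g e) x).symm
  have hφ : ∀ {a b : V} (w : S.toDirGraph.Walk a b),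
      ∃ L : Path x (w.word.eval g • x), ∀ t, φ (w.toPath t) = p (L t) := fun w =>
    w.exists_lift hp (f := φ) (fun _ => rfl) α (fun _ _ => rfl)
  have hd : ∀ f, ∃ d : C(Disk, StepSpace G), ∀ t, p (d (circlePt t)) = φ ((S.bdry f).toPath t) := by
    intro f
    obtain ⟨L, hL⟩ := hφ (S.bdry f)
    -- Flatness makes the lift `L` of the boundary end at `1 • x = x`, so it is a loop in a
    -- contractible space.
    obtain ⟨d, hd⟩ := exists_disk_extension (L : C(I, StepSpace G)) (by simp [hg f])
    exact ⟨d, fun t => by rw [hd, hL]; rfl⟩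
  choose d hd using hd
  let Φ := S.lift φ (fun f => p.comp (d f)) hd
  obtain ⟨L, hL⟩ := hφ γ
  have hom := (not_not.1 hγ).map Φ
  have hcov := hq.isCoveringMap
  have h0 := (hL 0).trans (congrArg p L.source)
  -- Homotopic paths have lifts with the same endpoint. By uniqueness the two lifts are `L`, ending
  -- at the holonomy times `x`, and the constant path at `x`; freeness of the action finishes.
  have h1 := hcov.liftPath_apply_one_eq_of_homotopicRel hom x (Path.source _) (Path.source _)
  have h2 := (hcov.eq_liftPath_iff' (e := x) (Γ := L.toContinuousMap)
    (γ := ((γ.toPath.map S.continuous_incl).map Φ.continuous).toContinuousMap) h0).2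
    ⟨funext fun t => (hL t).symm, L.source⟩
  have h3 := (hcov.eq_liftPath_iff' (e := x) (Γ := (Path.refl x).toContinuousMap)
    (γ := ((Path.refl (S.incl (S.toDirGraph.pt a))).map Φ.continuous).toContinuousMap) rfl).2
    ⟨funext fun t => rfl, rfl⟩
  rw [← h2, ← h3] at h1
  exact StepSpace.eq_one_of_smul_eq (f := x) (L.target.symm.trans h1)

end TwoComplex

end QDouble

/-! ### Edge paths and their homotopy classes -/

namespace QDouble

open unitInterval Topology

theorem Word.eval_append {E : Type v} {G : Type z} [Group G] (x y : Word E) (g : E → G) :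
    Word.eval (x ++ y) g = Word.eval x g * Word.eval y g := by
  simp [Word.eval]

namespace DirGraph

variable {V : Type u} {E : Type v} {Γ : DirGraph V E}

/-- Concatenation of edge paths. -/
def Walk.append : {a b c : V} → Γ.Walk a b → Γ.Walk b c → Γ.Walk a c
  | _, _, _, .nil _, q => q
  | _, _, _, .fwd e p, q => .fwd e (p.append q)
  | _, _, _, .bwd e p, q => .bwd e (p.append q)

/-- The reverse of an edge path. -/
def Walk.reverse : {a b : V} → Γ.Walk a b → Γ.Walk b a
  | _, _, .nil a => .nil a
  | _, _, .fwd e p => p.reverse.append (.bwd e (.nil _))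
  | _, _, .bwd e p => p.reverse.append (.fwd e (.nil _))

theorem Walk.word_append {a b c : V} (p : Γ.Walk a b) (q : Γ.Walk b c) :
    (p.append q).word = p.word ++ q.word := by
  induction p with
  | nil a => rfl
  | fwd e p ih => exact congrArg _ (ih q)
  | bwd e p ih => exact congrArg _ (ih q)

theorem Walk.eval_reverse {G : Type z} [Group G] (g : E → G) {a b : V} (p : Γ.Walk a b) :
    p.reverse.word.eval g = (p.word.eval g)⁻¹ := by
  induction p with
  | nil a => simp [Walk.reverse, Walk.word, Word.eval]
  | fwd e p ih =>
    rw [Walk.reverse, Walk.word_append, Word.eval_append, ih, Walk.word, Walk.word, Walk.word,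
      Word.eval_cons_true, Word.eval_cons_false, Word.eval_nil, mul_one, mul_inv_rev]
  | bwd e p ih =>
    rw [Walk.reverse, Walk.word_append, Word.eval_append, ih, Walk.word, Walk.word, Walk.word,
      Word.eval_cons_true, Word.eval_cons_false, Word.eval_nil, mul_one, mul_inv_rev, inv_inv]

theorem Walk.word_mapVert {V' : Type u} (π : V → V') {a b : V} (p : Γ.Walk a b) :
    (p.mapVert π).word = p.word := by
  induction p with
  | nil a => rfl
  | fwd e p ih => exact congrArg _ ih
  | bwd e p ih => exact congrArg _ ih

/-- Edge paths lift along an injective map of the vertices. -/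
theorem Walk.exists_mapVert_eq {V' : Type u} {π : V → V'} (hπ : Function.Injective π) {a' b' : V'}
    (p : (Γ.mapVert π).Walk a' b') :
    ∀ a, π a = a' → ∃ b, ∃ q : Γ.Walk a b, π b = b' ∧ HEq (q.mapVert π) p := by
  induction p with
  | nil a' =>
    rintro a rfl
    exact ⟨a, .nil a, rfl, HEq.rfl⟩
  | fwd e p ih =>
    intro a ha
    obtain rfl : a = Γ.src e := hπ ha
    obtain ⟨b, q, rfl, hq⟩ := ih (Γ.tgt e) rfl
    obtain rfl := eq_of_heq hq
    exact ⟨b, .fwd e q, rfl, HEq.rfl⟩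
  | bwd e p ih =>
    intro a ha
    obtain rfl : a = Γ.tgt e := hπ ha
    obtain ⟨b, q, rfl, hq⟩ := ih (Γ.src e) rfl
    obtain rfl := eq_of_heq hq
    exact ⟨b, .bwd e q, rfl, HEq.rfl⟩

/-- A map of the vertices induces a map of the spaces of the graphs. -/
theorem exists_map_mapVert (Γ : DirGraph V E) {V' : Type u} (π : V → V') :
    ∃ φ : C(Γ.Space, (Γ.mapVert π).Space), ∀ {a b : V} (w : Γ.Walk a b) (t : I),
      φ (w.toPath t) = (w.mapVert π).toPath t := by
  let φ := Γ.lift (fun a => (Γ.mapVert π).pt (π a)) fun e => (Γ.mapVert π).edgePath e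
  refine ⟨φ, ?_⟩
  intro a b w
  induction w with
  | nil a => exact fun t => rfl
  | fwd e w ih =>
    intro t
    refine (congrArg φ (Path.trans_apply (Γ.edgePath e) w.toPath t)).trans (Eq.trans ?_
      (Path.trans_apply ((Γ.mapVert π).edgePath e) (w.mapVert π).toPath t).symm)
    split_ifs
    · rfl
    · exact ih _
  | bwd e w ih =>
    intro t
    refine (congrArg φ (Path.trans_apply (Γ.edgePath e).symm w.toPath t)).trans (Eq.trans ?_
      (Path.trans_apply ((Γ.mapVert π).edgePath e).symm (w.mapVert π).toPath t).symm)
    split_ifs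
    · rfl
    · exact ih _

end DirGraph

namespace TwoComplex

variable {V : Type u} {E : Type v} {F : Type w} (S : TwoComplex V E F)

/-- The characteristic map of a 2-cell. -/
noncomputable def cell (f : F) : C(Disk, S.Space) where
  toFun x := Quot.mk _ (.inr ⟨f, x⟩)
  continuous_toFun := continuous_quot_mk.comp (continuous_inr.comp continuous_sigmaMk)

theorem cell_circlePt (f : F) (t : I) : S.cell f (circlePt t) = S.incl ((S.bdry f).toPath t) :=
  Quot.sound (Glue₂.attach f t)

/-- The homotopy class of an edge path. -/
noncomputable def homotopyClass {a b : V} (γ : S.toDirGraph.Walk a b) :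
    Path.Homotopic.Quotient (S.incl (S.toDirGraph.pt a)) (S.incl (S.toDirGraph.pt b)) :=
  .mk (γ.toPath.map S.continuous_incl)

/-- The homotopy class of an edge. -/
noncomputable def edgeClass (e : E) : Path.Homotopic.Quotient (S.incl (S.toDirGraph.pt (S.src e)))
    (S.incl (S.toDirGraph.pt (S.tgt e))) :=
  .mk ((S.toDirGraph.edgePath e).map S.continuous_incl)

variable {S}

theorem not_nonContractible_iff {a : V} {γ : S.toDirGraph.Walk a a} :
    ¬ S.NonContractible γ ↔ S.homotopyClass γ = .refl _ := by
  rw [NonContractible, not_not, homotopyClass, ← Path.Homotopic.Quotient.mk_refl,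
    Path.Homotopic.Quotient.eq]

open DirGraph Path.Homotopic.Quotient

theorem homotopyClass_nil (a : V) : S.homotopyClass (.nil a) = .refl _ := rfl

theorem homotopyClass_fwd (e : E) {b : V} (p : S.toDirGraph.Walk (S.tgt e) b) :
    S.homotopyClass (.fwd e p) = (S.edgeClass e).trans (S.homotopyClass p) := by
  rw [homotopyClass, Walk.toPath, Path.map_trans, mk_trans]
  rfl

theorem homotopyClass_bwd (e : E) {b : V} (p : S.toDirGraph.Walk (S.src e) b) :
    S.homotopyClass (.bwd e p) = (S.edgeClass e).symm.trans (S.homotopyClass p) := by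
  rw [homotopyClass, Walk.toPath, Path.map_trans, mk_trans]
  rfl

theorem homotopyClass_append {a b c : V} (p : S.toDirGraph.Walk a b) (q : S.toDirGraph.Walk b c) :
    S.homotopyClass (p.append q) = (S.homotopyClass p).trans (S.homotopyClass q) := by
  induction p with
  | nil a => rw [Walk.append, homotopyClass_nil, refl_trans]
  | fwd e p ih => rw [Walk.append, homotopyClass_fwd, homotopyClass_fwd, ih, trans_assoc]
  | bwd e p ih => rw [Walk.append, homotopyClass_bwd, homotopyClass_bwd, ih, trans_assoc]

theorem homotopyClass_trans_reverse {a b : V} (p : S.toDirGraph.Walk a b) :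
    (S.homotopyClass p).trans (S.homotopyClass p.reverse) = .refl _ := by
  induction p with
  | nil a => rw [Walk.reverse, homotopyClass_nil, refl_trans]
  | fwd e p ih =>
    rw [Walk.reverse, homotopyClass_append, homotopyClass_fwd, homotopyClass_bwd, homotopyClass_nil,
      trans_refl, trans_assoc, ← trans_assoc (S.homotopyClass p), ih, refl_trans, trans_symm]
  | bwd e p ih =>
    rw [Walk.reverse, homotopyClass_append, homotopyClass_fwd, homotopyClass_bwd, homotopyClass_nil,
      trans_refl, trans_assoc, ← trans_assoc (S.homotopyClass p), ih, refl_trans, symm_trans]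

theorem homotopyClass_reverse_trans {a b : V} (p : S.toDirGraph.Walk a b) :
    (S.homotopyClass p.reverse).trans (S.homotopyClass p) = .refl _ := by
  have h := congrArg ((S.homotopyClass p).symm.trans ·) (homotopyClass_trans_reverse p)
  simp only [← trans_assoc, symm_trans, refl_trans, trans_refl] at h
  rw [h, symm_trans]

/-- The boundary of a 2-cell is null-homotopic. -/
theorem homotopyClass_bdry (f : F) : S.homotopyClass (S.bdry f) = .refl _ := by
  let c : Path (circlePt 0) (circlePt 0) := ⟨⟨circlePt, continuous_circlePt⟩, rfl,
    circlePt_zero_eq_one.symm⟩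
  -- The boundary circle is null-homotopic in the disk, and the characteristic map carries the
  -- homotopy into the complex.
  have h := ((SimplyConnectedSpace.paths_homotopic c (.refl _)).map (S.cell f))
  have h0 : S.incl (S.toDirGraph.pt (S.base f)) = S.cell f (circlePt 0) := by
    rw [cell_circlePt, Path.source]
  have h1 := h.pathCast h0 h0
  rw [← not_nonContractible_iff, NonContractible, not_not]
  convert h1 using 1
  · ext t
    exact (S.cell_circlePt f t).symm
  · ext t
    exact h0

/-- Null-homotopic closed edge paths remain null-homotopic when vertices are identified. -/
theorem not_nonContractible_collapse {Y : Set V} {a : V} {γ : S.toDirGraph.Walk a a}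
    (hγ : ¬ S.NonContractible γ) : ¬ (S.collapse Y).NonContractible (γ.mapVert (Quot.mk _)) := by
  let T := S.collapse Y
  obtain ⟨φ, hφ⟩ := S.toDirGraph.exists_map_mapVert (Quot.mk fun a b : V => a ∈ Y ∧ b ∈ Y)
  let Φ : C(S.Space, T.Space) :=
    S.lift ⟨_, T.continuous_incl.comp φ.continuous⟩ T.cell fun f t =>
      (T.cell_circlePt f t).trans (congrArg T.incl (hφ (S.bdry f) t).symm)
  have h0 : T.incl (T.toDirGraph.pt (Quot.mk _ a)) = Φ (S.incl (S.toDirGraph.pt a)) :=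
    congrArg T.incl (hφ (.nil a) 0).symm
  have h := ((not_not.1 hγ).map Φ).pathCast h0 h0
  refine not_not.2 ?_
  convert h using 1
  · exact Path.ext (funext fun t => congrArg T.incl (hφ γ t).symm)
  · exact Path.ext (funext fun t => h0)

/-- Suppose that for every edge and every choice of holonomy the complex has a 2-cell that relates
chosen representatives of edge paths. Then every edge path is homotopic to a representative. -/
theorem not_nonContractible_of_eval_eq_one {H : Type*} [Group H] (h : E → H)
    (r : ∀ a b (k : H), (∃ p : S.toDirGraph.Walk a b, p.word.eval h = k) → S.toDirGraph.Walk a b)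
    (hS : ∀ a e k (h₁ : ∃ p : S.toDirGraph.Walk a (S.src e), p.word.eval h = k)
      (h₂ : ∃ p : S.toDirGraph.Walk a (S.tgt e), p.word.eval h = k * h e),
      S.homotopyClass ((r _ _ _ h₁).append (.fwd e (r _ _ _ h₂).reverse)) = .refl _)
    {a : V} {γ : S.toDirGraph.Walk a a} (hγ : γ.word.eval h = 1) : ¬ S.NonContractible γ := by
  have step : ∀ a e k (h₁ : ∃ p : S.toDirGraph.Walk a (S.src e), p.word.eval h = k)
      (h₂ : ∃ p : S.toDirGraph.Walk a (S.tgt e), p.word.eval h = k * h e),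
      (S.homotopyClass (r _ _ _ h₁)).trans (S.edgeClass e) = S.homotopyClass (r _ _ _ h₂) := by
    intro a e k h₁ h₂
    have := congrArg (·.trans (S.homotopyClass (r _ _ _ h₂))) (hS a e k h₁ h₂)
    simpa only [homotopyClass_append, homotopyClass_fwd, trans_assoc, homotopyClass_reverse_trans,
      refl_trans, trans_refl] using this
  -- Appending `p` to a representative gives the representative for the product of holonomies, by
  -- induction on `p` with `step` at each edge.
  have main : ∀ {b c : V} (p : S.toDirGraph.Walk b c) a k
      (h₁ : ∃ q : S.toDirGraph.Walk a b, q.word.eval h = k)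
      (h₂ : ∃ q : S.toDirGraph.Walk a c, q.word.eval h = k * p.word.eval h),
      (S.homotopyClass (r _ _ _ h₁)).trans (S.homotopyClass p) =
        S.homotopyClass (r _ _ _ h₂) := by
    intro b c p
    induction p with
    | nil b =>
      intro a k h₁ h₂
      have : k * Word.eval (Walk.nil (Γ := S.toDirGraph) b).word h = k := mul_one k
      rw [homotopyClass_nil, trans_refl]
      congr 2
      exact this.symm
    | fwd e p ih =>
      intro a k h₁ h₂
      have h₃ : ∃ q : S.toDirGraph.Walk a (S.tgt e), q.word.eval h = k * h e := by
        obtain ⟨q, hq⟩ := h₁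
        refine ⟨q.append (.fwd e (.nil _)), ?_⟩
        rw [Walk.word_append, Word.eval_append, hq, Walk.word, Word.eval_cons_true, Walk.word,
          Word.eval_nil, mul_one]
      have e1 : k * Word.eval (Walk.fwd e p).word h = k * h e * Word.eval p.word h := by
        rw [Walk.word, Word.eval_cons_true, mul_assoc]
      rw [homotopyClass_fwd, ← trans_assoc, step a e k h₁ h₃, ih a _ h₃ (e1 ▸ h₂)]
      congr 2
      exact e1.symm
    | bwd e p ih =>
      intro a k h₁ h₂
      have h₃ : ∃ q : S.toDirGraph.Walk a (S.src e), q.word.eval h = k * (h e)⁻¹ := by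
        obtain ⟨q, hq⟩ := h₁
        refine ⟨q.append (.bwd e (.nil _)), ?_⟩
        rw [Walk.word_append, Word.eval_append, hq, Walk.word, Word.eval_cons_false, Walk.word,
          Word.eval_nil, mul_one]
      have e1 : k * Word.eval (Walk.bwd e p).word h = k * (h e)⁻¹ * Word.eval p.word h := by
        rw [Walk.word, Word.eval_cons_false, mul_assoc]
      have e2 : k * (h e)⁻¹ * h e = k := inv_mul_cancel_right k (h e)
      -- A backward edge uses `step` from right to left, starting with the value `k * (h e)⁻¹`.
      have e3 : S.homotopyClass (r _ _ _ h₁) =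
          (S.homotopyClass (r _ _ _ h₃)).trans (S.edgeClass e) := by
        rw [step a e _ h₃ (e2.symm ▸ h₁)]
        congr 2
        exact e2.symm
      rw [homotopyClass_bwd, e3, trans_assoc, ← trans_assoc (S.edgeClass e), trans_symm, refl_trans,
        ih a _ h₃ (e1 ▸ h₂)]
      congr 2
      exact e1.symm
  have e0 : ∃ q : S.toDirGraph.Walk a a, q.word.eval h = 1 := ⟨γ, hγ⟩
  have e1 := main γ a 1 e0 (by rw [hγ, mul_one]; exact e0)
  have e2 : (S.homotopyClass (r _ _ _ e0)).trans (S.homotopyClass γ) =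
      S.homotopyClass (r _ _ _ e0) := by
    rw [e1]
    congr 2
    rw [hγ, mul_one]
  -- The representative of the trivial value absorbs `γ`; it need not be the constant path, but it
  -- cancels.
  have e3 := congrArg ((S.homotopyClass (r _ _ _ e0)).symm.trans ·) e2
  rw [not_nonContractible_iff]
  simpa only [← trans_assoc, symm_trans, refl_trans] using e3

end TwoComplex

end QDouble

namespace QDouble

/-! ### Gauge transformations -/

section

variable {E : Type v} {G : Type z} [Group G]

theorem Word.eval_congr [DecidableEq E] {x : Word E} {g g' : E → G}
    (h : ∀ e ∈ x.qudits, g e = g' e) : x.eval g = x.eval g' := by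
  unfold Word.eval
  congr 1
  refine List.map_congr_left fun p hp => ?_
  rw [h p.1 (List.mem_toFinset.2 (List.mem_map_of_mem hp))]

theorem Word.eval_one (x : Word E) : x.eval (1 : E → G) = 1 := by
  unfold Word.eval
  refine List.prod_eq_one fun y hy => ?_
  obtain ⟨p, -, rfl⟩ := List.mem_map.1 hy
  simp

/-- Lets a single configuration with values in a power of `G` record the holonomies of all flat
configurations at once. -/
theorem Word.eval_pi {ι : Type*} (x : Word E) (h : E → ι → G) (i : ι) :
    x.eval h i = x.eval fun e => h e i := by
  change Pi.evalMonoidHom (fun _ : ι => G) i (List.prod _) = List.prod _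
  rw [map_list_prod, List.map_map]
  congr 2
  funext p
  simp only [Function.comp, Pi.evalMonoidHom_apply]
  split_ifs <;> rfl

end

namespace DirGraph

variable {V : Type u} {E : Type v} (Γ : DirGraph V E) {G : Type z} [Group G]

/-- The action of a gauge transformation, a function on the vertices, on a configuration. -/
def gauge (t : V → G) (g : E → G) : E → G := fun e => t (Γ.src e) * g e * (t (Γ.tgt e))⁻¹

theorem gauge_mul (s t : V → G) (g : E → G) :
    Γ.gauge (s * t) g = Γ.gauge s (Γ.gauge t g) := by
  funext e
  simp only [gauge, Pi.mul_apply, mul_inv_rev, mul_assoc]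

theorem gauge_one (g : E → G) : Γ.gauge 1 g = g := by
  funext e
  simp [gauge]

/-- A gauge transformation as a permutation of the configurations. -/
def gaugeEquiv (t : V → G) : (E → G) ≃ (E → G) where
  toFun := Γ.gauge t
  invFun := Γ.gauge t⁻¹
  left_inv g := by rw [← gauge_mul, inv_mul_cancel, gauge_one]
  right_inv g := by rw [← gauge_mul, mul_inv_cancel, gauge_one]

variable {Γ}

/-- The factors at intermediate vertices telescope. For a closed path only a conjugation remains, so
trivial holonomy is gauge invariant. -/
theorem Walk.eval_gauge (t : V → G) (g : E → G) {a b : V} (p : Γ.Walk a b) :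
    p.word.eval (Γ.gauge t g) = t a * p.word.eval g * (t b)⁻¹ := by
  induction p with
  | nil a => simp [Walk.word, Word.eval]
  | fwd e p ih =>
    rw [Walk.word, Word.eval_cons_true, Word.eval_cons_true, ih, gauge]
    group
  | bwd e p ih =>
    rw [Walk.word, Word.eval_cons_false, Word.eval_cons_false, ih, gauge]
    group

theorem Walk.qudits_card_le_length [DecidableEq E] {a b : V} (p : Γ.Walk a b) :
    p.word.qudits.card ≤ p.length :=
  (List.toFinset_card_le _).trans (List.length_map _).le

/-- The simple graph on the vertices that is spanned by a set of edges. -/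
def spanned (Γ : DirGraph V E) (A : Finset E) : SimpleGraph V :=
  SimpleGraph.fromRel fun a b => ∃ e ∈ A, Γ.src e = a ∧ Γ.tgt e = b

theorem reachable_spanned {A : Finset E} {e : E} (he : e ∈ A) :
    (Γ.spanned A).Reachable (Γ.src e) (Γ.tgt e) := by
  by_cases h : Γ.src e = Γ.tgt e
  · rw [h]
  · exact SimpleGraph.Adj.reachable ((SimpleGraph.fromRel_adj _ _ _).2
      ⟨h, Or.inl ⟨e, he, rfl, rfl⟩⟩)

/-- A path repeats no edge of the simple graph, and each of these edges comes from an element of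
`A`. -/
theorem length_le_card_of_isPath {A : Finset E} {a b : V} {q : (Γ.spanned A).Walk a b}
    (hq : q.IsPath) : q.length ≤ A.card := by
  classical
  rw [← SimpleGraph.Walk.length_edges, ← List.toFinset_card_of_nodup hq.isTrail.edges_nodup]
  refine (Finset.card_le_card fun s hs => ?_).trans
    (Finset.card_image_le (f := fun e => s(Γ.src e, Γ.tgt e)))
  have hs' := q.edges_subset_edgeSet (List.mem_toFinset.1 hs)
  induction s with
  | _ a b =>
    rw [SimpleGraph.mem_edgeSet] at hs'
    rw [Finset.mem_image]
    obtain ⟨-, ⟨e, he, rfl, rfl⟩ | ⟨e, he, rfl, rfl⟩⟩ := (SimpleGraph.fromRel_adj _ _ _).1 hs'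
    · exact ⟨e, he, rfl⟩
    · exact ⟨e, he, Sym2.eq_swap⟩

/-- On `A` the configuration is `(t (src e))⁻¹ * t (tgt e)`, so holonomies inside `A` telescope. -/
theorem exists_walk_of_spanned {A : Finset E} {t : V → G} {g : E → G}
    (ht : ∀ e ∈ A, Γ.gauge t g e = 1) {a b : V} (q : (Γ.spanned A).Walk a b) :
    ∃ p : Γ.Walk a b, p.length = q.length ∧ p.word.eval g = (t a)⁻¹ * t b := by
  induction q with
  | nil => exact ⟨.nil _, rfl, by simp [Walk.word, Word.eval]⟩
  | cons h q ih =>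
    obtain ⟨p, hp, hpg⟩ := ih
    obtain ⟨-, ⟨e, he, rfl, rfl⟩ | ⟨e, he, rfl, rfl⟩⟩ := (SimpleGraph.fromRel_adj _ _ _).1 h
    · refine ⟨.fwd e p, congrArg (· + 1) hp, ?_⟩
      have h1 := ht e he
      rw [gauge, mul_inv_eq_one] at h1
      rw [Walk.word, Word.eval_cons_true, hpg, ← h1]
      group
    · refine ⟨.bwd e p, congrArg (· + 1) hp, ?_⟩
      have h1 := ht e he
      rw [gauge, mul_inv_eq_one] at h1
      rw [Walk.word, Word.eval_cons_false, hpg, ← h1]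
      group

/-- If the holonomy along all short closed edge paths is trivial, a gauge transformation trivializes
the configuration on a given set of edges. -/
theorem exists_gauge_eq_one (g : E → G) (A : Finset E)
    (h : ∀ a (γ : Γ.Walk a a), γ.length ≤ A.card → γ.word.eval g = 1) :
    ∃ t : V → G, ∀ e ∈ A, Γ.gauge t g e = 1 := by
  classical
  induction A using Finset.induction_on with
  | empty => exact ⟨1, by simp⟩
  | insert e A he ih =>
    rw [Finset.card_insert_of_notMem he] at h
    obtain ⟨t, ht⟩ := ih fun a γ hγ => h a γ (hγ.trans (Nat.le_succ _))
    by_cases hr : (Γ.spanned A).Reachable (Γ.tgt e) (Γ.src e)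
    -- If `e` closes a loop with edges of `A`, that loop can be chosen of length at most `A.card +
    -- 1`. Its trivial holonomy forces `t` to trivialize `e` already.
    · obtain ⟨q, hq⟩ := hr.exists_isPath
      obtain ⟨p, hp, hpg⟩ := exists_walk_of_spanned ht q
      have h1 := h _ (.fwd e p)
        (Nat.succ_le_succ (hp.trans_le (length_le_card_of_isPath hq)))
      rw [Walk.word, Word.eval_cons_true, hpg] at h1
      refine ⟨t, fun e' he' => ?_⟩
      rcases Finset.mem_insert.1 he' with rfl | he'
      · rw [gauge, mul_assoc]
        exact mul_eq_one_comm.1 ((mul_assoc _ _ _).trans h1)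
      · exact ht e' he'
    -- Otherwise `t` is changed by `c` on the component of `tgt e`, which misses `src e`; `c` is the
    -- value that makes `e` trivial. Edges of `A` have both ends or neither in this component, so
    -- they stay trivial.
    · let c := t (Γ.src e) * g e * (t (Γ.tgt e))⁻¹
      refine ⟨fun v => if (Γ.spanned A).Reachable (Γ.tgt e) v then c * t v else t v,
        fun e' he' => ?_⟩
      rcases Finset.mem_insert.1 he' with rfl | he'
      · simp only [gauge, hr, if_false, SimpleGraph.Reachable.refl, if_true, c]
        group
      · have h1 := ht e' he'
        rw [gauge] at h1
        have h2 : (Γ.spanned A).Reachable (Γ.tgt e) (Γ.src e') ↔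
            (Γ.spanned A).Reachable (Γ.tgt e) (Γ.tgt e') :=
          ⟨fun h => h.trans (reachable_spanned he'), fun h => h.trans (reachable_spanned he').symm⟩
        simp only [gauge, h2]
        split_ifs
        · rw [mul_inv_rev, mul_assoc c, mul_assoc c, ← mul_assoc _ _ c⁻¹, h1, one_mul,
            mul_inv_cancel]
        · exact h1

end DirGraph

/-! ### Code states -/

namespace TwoComplex

variable {V : Type u} {E : Type v} {F : Type w} (S : TwoComplex V E F) {G : Type z} [Group G]

/-- A configuration is flat if its holonomy around every 2-cell is trivial. -/
def IsFlat (g : E → G) : Prop := ∀ f, (S.bdry f).word.eval g = 1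

theorem isFlat_one : S.IsFlat (1 : E → G) := fun _ => Word.eval_one _

variable {S}

theorem isFlat_gauge_iff {t : V → G} {g : E → G} : S.IsFlat (S.gauge t g) ↔ S.IsFlat g :=
  forall_congr' fun f => by
    rw [DirGraph.Walk.eval_gauge, mul_inv_eq_one, mul_eq_left]

/-- The inverse appears because moving basis vectors by a permutation composes wave functions with
its inverse. -/
theorem xOp_vertexCheck_apply [DecidableEq V] (a : V) (x : G) (ψ : Phys E G) (g : E → G) :
    xOp (S.vertexCheck a x).1 (S.vertexCheck a x).2 ψ g =
      ψ (S.gauge (Pi.mulSingle a x⁻¹) g) := by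
  change ψ _ = ψ _
  congr 1
  funext e
  simp only [vertexCheck, DirGraph.gauge, Pi.mul_apply, Pi.inv_apply, Pi.mulSingle_apply]
  split_ifs <;> simp

theorem zOp_eq_self_iff (x : Word E) (ψ : Phys E G) :
    zOp x ⊥ ψ = ψ ↔ ∀ g, x.eval g ≠ 1 → ψ g = 0 := by
  change Set.indicator _ ψ = ψ ↔ _
  rw [Set.indicator_eq_self, Function.support_subset_iff']
  rfl

/-- The code states are the functions on the flat configurations that are invariant under gauge
transformations that are trivial at the ghost vertices. -/
theorem mem_doubleCode_iff [Finite V] {Y : Set V} {ψ : Phys E G} :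
    ψ ∈ S.doubleCode G Y ↔
      (∀ t : V → G, (∀ a ∈ Y, t a = 1) → ∀ g, ψ (S.gauge t g) = ψ g) ∧
        ∀ g, ¬ S.IsFlat g → ψ g = 0 := by
  classical
  have h0 : ψ ∈ S.doubleCode G Y ↔
      (∀ a ∉ Y, ∀ (x : G) g, ψ (S.gauge (Pi.mulSingle a x) g) = ψ g) ∧
        ∀ g, ¬ S.IsFlat g → ψ g = 0 := by
    refine and_congr ⟨fun h a ha x g => ?_, ?_⟩ ⟨fun h g hg => ?_, ?_⟩
    · have h1 := congrFun (h _ ⟨a, ha, x⁻¹, rfl⟩) g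
      rwa [xOp_vertexCheck_apply, inv_inv] at h1
    · rintro h _ ⟨a, ha, x, rfl⟩
      funext g
      rw [xOp_vertexCheck_apply, h a ha]
    · obtain ⟨f, hf⟩ := not_forall.1 hg
      exact (zOp_eq_self_iff _ _).1 (h _ ⟨f, rfl⟩) g hf
    · rintro h _ ⟨f, rfl⟩
      exact (zOp_eq_self_iff _ _).2 fun g hg => h g fun h' => hg (h' f)
  rw [h0]
  refine and_congr_left fun _ => ⟨fun h t ht => ?_, fun h a ha x => h _ fun b hb => ?_⟩
  -- The transformations fixing `ψ` are closed under products, and for finite `V` those supported at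
  -- single vertices generate.
  · let H : Submonoid (V → G) :=
      { carrier := {t | ∀ g, ψ (S.gauge t g) = ψ g}
        one_mem' := fun g => by rw [DirGraph.gauge_one]
        mul_mem' := fun hs ht g => by rw [DirGraph.gauge_mul, hs, ht] }
    refine Submonoid.pi_mem_of_mulSingle_mem (H := H) t fun a => ?_
    by_cases ha : a ∈ Y
    · rw [ht a ha, Pi.mulSingle_one]
      exact H.one_mem
    · exact h a ha (t a)
  · rw [Pi.mulSingle_eq_of_ne]
    rintro rfl
    exact ha hb

end TwoComplex

end QDouble

/-! ### Logical operators, the distance, and saturated complexes -/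

namespace QDouble

open DirGraph

open scoped ComplexOrder

theorem quot_mk_eq_iff {V : Type u} {Y : Set V} {a b : V} :
    Quot.mk (fun a b : V => a ∈ Y ∧ b ∈ Y) a = Quot.mk _ b ↔ a = b ∨ (a ∈ Y ∧ b ∈ Y) := by
  refine ⟨fun h => ?_, ?_⟩
  · have h1 := Quot.eqvGen_exact h
    clear h
    induction h1 with
    | rel _ _ h => exact Or.inr h
    | refl => exact Or.inl rfl
    | symm _ _ _ ih => exact ih.imp Eq.symm And.symm
    | trans _ _ _ _ _ ih₁ ih₂ =>
      rcases ih₁ with rfl | ih₁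
      · exact ih₂
      · rcases ih₂ with rfl | ih₂
        · exact Or.inr ih₁
        · exact Or.inr ⟨ih₁.1, ih₂.2⟩
  · rintro (rfl | h)
    · rfl
    · exact Quot.sound h

namespace TwoComplex

variable {V : Type u} {E : Type v} {F : Type w} {S : TwoComplex V E F} {G : Type z} [Group G]

/-- The holonomy check along a loop that is not always trivial is a logical operator. -/
theorem isZLogical_of_eval_ne_one [Finite V] [Fintype E] [DecidableEq E] [Fintype G] {Y : Set V}
    {a : Quot fun a b : V => a ∈ Y ∧ b ∈ Y} (γ : (S.collapse Y).toDirGraph.Walk a a) {g : E → G}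
    (hg : S.IsFlat g) (hγ : γ.word.eval g ≠ 1) : IsZLogical (S.doubleCode G Y) γ.word ⊥ := by
  classical
  have inv : ∀ t : V → G, (∀ b ∈ Y, t b = 1) → ∀ g : E → G,
      γ.word.eval (S.gauge t g) = 1 ↔ γ.word.eval g = 1 := by
    intro t ht g
    -- A transformation trivial on `Y` descends to `Σ/Y`, where `γ` is closed, so it only conjugates
    -- the holonomy.
    let t' : (Quot fun a b : V => a ∈ Y ∧ b ∈ Y) → G :=
      Quot.lift t fun a b h => (ht a h.1).trans (ht b h.2).symm
    have h1 : S.gauge t g = (S.collapse Y).gauge t' g := rfl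
    rw [h1, Walk.eval_gauge, mul_inv_eq_one, mul_eq_left]
  -- `s id` and `s Not` are the indicators of the flat configurations with trivial and nontrivial
  -- holonomy along `γ`. Both are nonzero code states, with eigenvalues 1 and 0, so no constant `c`
  -- serves both.
  let s (P : Prop → Prop) : Phys E G :=
    fun g => if S.IsFlat g ∧ P (γ.word.eval g = 1) then 1 else 0
  have hs : ∀ P, s P ∈ S.doubleCode G Y := fun P => mem_doubleCode_iff.2
    ⟨fun t ht g => by simp only [s, isFlat_gauge_iff, inv t ht], fun g hg => if_neg fun h => hg h.1⟩
  have hz : ∀ (ψ : Phys E G) (g : E → G),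
      zOp γ.word ⊥ ψ g = if γ.word.eval g = 1 then ψ g else 0 := fun ψ g => rfl
  refine ⟨fun ψ hψ => ?_, ?_⟩
  · rw [mem_doubleCode_iff] at hψ ⊢
    refine ⟨fun t ht g => ?_, fun g hg => ?_⟩
    · rw [hz, hz, hψ.1 t ht]
      simp only [inv t ht]
    · rw [hz, hψ.2 g hg, ite_self]
  · rintro ⟨c, hc⟩
    have h1 : zOp γ.word ⊥ (s id) = s id := by
      funext g
      rw [hz]
      by_cases h : γ.word.eval g = 1 <;> simp [s, h]
    have h2 : zOp γ.word ⊥ (s Not) = 0 := by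
      funext g
      rw [hz]
      by_cases h : γ.word.eval g = 1 <;> simp [s, h]
    have h3 := hc _ (hs id) _ (hs id)
    have h4 := hc _ (hs Not) _ (hs Not)
    rw [h1] at h3
    rw [h2, dotProduct_zero] at h4
    have h5 : s id ≠ 0 := fun h => by
      have := congrFun h 1
      simp [s, isFlat_one, Word.eval_one] at this
    have h6 : s Not ≠ 0 := fun h => by
      have := congrFun h g
      simp [s, hg, hγ] at this
    have h7 : c = 0 := (mul_eq_zero.1 h4.symm).resolve_right (mt dotProduct_star_self_eq_zero.1 h6)
    rw [h7, zero_mul] at h3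
    exact h5 (dotProduct_star_self_eq_zero.1 h3)

/-- The Knill-Laflamme condition holds for an operator if on its qudits every flat configuration is
gauge equivalent to the trivial one. -/
theorem knillLaflamme_of_exists_gauge [Finite V] [Fintype E] [DecidableEq E] [Fintype G]
    {Y : Set V} (x : Word E) (K : Subgroup G)
    (h : ∀ g : E → G, S.IsFlat g →
      ∃ t : V → G, (∀ a ∈ Y, t a = 1) ∧ ∀ e ∈ x.qudits, S.gauge t g e = 1) :
    KnillLaflamme (S.doubleCode G Y) (zOp x K) := by
  classical
  let T : Subgroup (V → G) :=
    { carrier := {t | ∀ a ∈ Y, t a = 1}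
      one_mem' := fun a _ => rfl
      mul_mem' := fun hs ht a ha => by rw [Pi.mul_apply, hs a ha, ht a ha, one_mul]
      inv_mem' := fun ht a ha => by rw [Pi.inv_apply, ht a ha, inv_one] }
  have := Fintype.ofFinite T
  let χ : (E → G) → ℂ := fun g => if x.eval g ∈ K then 1 else 0
  have hN : (Fintype.card T : ℂ) ≠ 0 := Nat.cast_ne_zero.2 Fintype.card_ne_zero
  -- The constant is the average of the diagonal entry over the gauge orbit of the trivial
  -- configuration. The average over the orbit of any flat `g` is the same: translate the sum by the
  -- `s` that trivializes `g` on the qudits of `x`.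
  refine ⟨(∑ t : T, χ (S.gauge t 1)) / Fintype.card T, fun ψ hψ φ hφ => ?_⟩
  rw [mem_doubleCode_iff] at hψ hφ
  have hχ : ∀ g : E → G, S.IsFlat g → ∑ t : T, χ (S.gauge t g) = ∑ t : T, χ (S.gauge t 1) := by
    intro g hg
    obtain ⟨s, hs, hs1⟩ := h g hg
    rw [← Equiv.sum_comp (Equiv.mulRight (⟨s, hs⟩ : T))]
    refine Finset.sum_congr rfl fun t _ => ?_
    have : x.eval (S.gauge (t * s : V → G) g) = x.eval (S.gauge (t : V → G) 1) := by
      refine Word.eval_congr fun e he => ?_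
      rw [gauge_mul]
      simp only [DirGraph.gauge] at hs1 ⊢
      rw [hs1 e he, Pi.one_apply]
    simp only [χ, Equiv.coe_mulRight, Subgroup.coe_mul, this]
  -- Reindexing the configurations by `t` moves only `χ`, since `ψ` and `φ` are invariant.
  have h1 : ∀ t : T, star ψ ⬝ᵥ zOp x K φ = ∑ g, star (ψ g) * φ g * χ (S.gauge t g) := by
    intro t
    rw [dotProduct, ← Equiv.sum_comp (S.gaugeEquiv (t : V → G))]
    refine Finset.sum_congr rfl fun g _ => ?_
    have e1 : zOp x K φ (S.gauge t g) = if x.eval (S.gauge t g) ∈ K then φ (S.gauge t g) else 0 :=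
      rfl
    change star (ψ (S.gauge t g)) * zOp x K φ (S.gauge t g) = _
    rw [e1, hψ.1 t t.2, hφ.1 t t.2]
    simp only [χ]
    split_ifs <;> simp
  have h2 : (Fintype.card T : ℂ) * (star ψ ⬝ᵥ zOp x K φ) =
      (∑ t : T, χ (S.gauge t 1)) * (star ψ ⬝ᵥ φ) := by
    calc (Fintype.card T : ℂ) * (star ψ ⬝ᵥ zOp x K φ)
        = ∑ t : T, ∑ g, star (ψ g) * φ g * χ (S.gauge t g) := by
          rw [← Finset.sum_congr rfl fun t _ => h1 t, Finset.sum_const, Finset.card_univ,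
            nsmul_eq_mul]
      _ = ∑ g, star (ψ g) * φ g * ∑ t : T, χ (S.gauge t g) := by
          rw [Finset.sum_comm]
          simp only [Finset.mul_sum]
      _ = ∑ g, star (ψ g) * φ g * ∑ t : T, χ (S.gauge t 1) := by
          refine Finset.sum_congr rfl fun g _ => ?_
          by_cases hg : S.IsFlat g
          · rw [hχ g hg]
          · rw [hψ.2 g hg, star_zero, zero_mul, zero_mul, zero_mul]
      _ = (∑ t : T, χ (S.gauge t 1)) * (star ψ ⬝ᵥ φ) := by
          rw [← Finset.sum_mul, mul_comm]
          rfl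
  rw [div_mul_eq_mul_div, eq_div_iff hN, mul_comm, h2]

/-- An operator that violates the Knill-Laflamme condition acts on at least as many qudits as the
shortest non-contractible loop has edges. -/
theorem systole_le_card [Finite V] [Fintype E] [DecidableEq E] [Fintype G] {Y : Set V} {x : Word E}
    {K : Subgroup G} (h : ¬ KnillLaflamme (S.doubleCode G Y) (zOp x K)) :
    (S.collapse Y).systole ≤ x.qudits.card := by
  contrapose! h
  refine knillLaflamme_of_exists_gauge x K fun g hg => ?_
  obtain ⟨t, ht⟩ := exists_gauge_eq_one (Γ := (S.collapse Y).toDirGraph) g x.qudits fun a γ hγ => by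
    refine (S.collapse Y).eval_eq_one_of_not_nonContractible (fun f => ?_) fun hnc => ?_
    · exact (congrArg (Word.eval · g) (Walk.word_mapVert _ _)).trans (hg f)
    · refine h.not_ge ((iInf_le_of_le a (iInf_le_of_le γ (iInf_le _ hnc))).trans ?_)
      exact_mod_cast hγ
  -- A constant left factor conjugates the gauged values, so trivial ones stay trivial. This freedom
  -- normalizes `t` to 1 at the collapsed vertex.
  have key : ∀ c : G, ∀ e ∈ x.qudits, S.gauge (fun a => c * t (Quot.mk _ a)) g e = 1 := by
    intro c e he
    have h1 : t (Quot.mk _ (S.src e)) * g e * (t (Quot.mk _ (S.tgt e)))⁻¹ = 1 := ht e he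
    rw [DirGraph.gauge, mul_inv_rev, mul_assoc c, mul_assoc c, ← mul_assoc _ _ c⁻¹, h1, one_mul,
      mul_inv_cancel]
  rcases Y.eq_empty_or_nonempty with rfl | ⟨y, hy⟩
  · exact ⟨_, by simp, key 1⟩
  · refine ⟨_, fun a ha => ?_, key (t (Quot.mk _ y))⁻¹⟩
    have : Quot.mk (fun a b : V => a ∈ Y ∧ b ∈ Y) a = Quot.mk _ y := Quot.sound ⟨ha, hy⟩
    rw [this, inv_mul_cancel]

/-- The upper bound holds because a logical operator on a loop violates the Knill-Laflamme condition
and acts on at most as many qudits as the loop has edges; the lower bound is `systole_le_card`. -/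
theorem dZ_eq_systole [Finite V] [Fintype E] [DecidableEq E] [Fintype G] {Y : Set V}
    (h : ∀ (a : Quot fun a b : V => a ∈ Y ∧ b ∈ Y) (γ : (S.collapse Y).toDirGraph.Walk a a),
      (S.collapse Y).NonContractible γ → S.SupportsZLogical G Y γ) :
    dZ (S.doubleCode G Y) = (S.collapse Y).systole := by
  refine le_antisymm ?_ ?_
  · refine le_iInf fun a => le_iInf fun γ => le_iInf fun hγ => ?_
    obtain ⟨x, K, hx, hxK⟩ := h a γ hγ
    refine (iInf_le_of_le x (iInf_le_of_le K (iInf_le _ hxK.2))).trans ?_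
    exact_mod_cast (Finset.card_le_card hx).trans γ.qudits_card_le_length
  · exact le_iInf fun x => le_iInf fun K => le_iInf fun h => systole_le_card h

/-- If vertices in `Y` are identified and 2-cells are exchanged without a change of the flat
configurations, the code remains the same. -/
theorem doubleCode_eq_of_isFlat_iff {F' : Type*} [Finite V] {Y : Set V}
    {S' : TwoComplex (Quot fun a b : V => a ∈ Y ∧ b ∈ Y) E F'}
    (hS' : S'.toDirGraph = S.toDirGraph.mapVert (Quot.mk _))
    (h : ∀ g : E → G, S'.IsFlat g ↔ S.IsFlat g) :
    S'.doubleCode G (Quot.mk _ '' Y) = S.doubleCode G Y := by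
  ext ψ
  rw [mem_doubleCode_iff, mem_doubleCode_iff]
  refine and_congr ⟨fun hψ t ht g => ?_, fun hψ t ht g => ?_⟩ (by simp only [h])
  · have := hψ (Quot.lift t fun a b h => (ht a h.1).trans (ht b h.2).symm)
      (by rintro _ ⟨a, ha, rfl⟩; exact ht a ha) g
    rwa [hS'] at this
  · have := hψ (fun a => t (Quot.mk _ a)) (fun a ha => ht _ ⟨a, ha, rfl⟩) g
    rwa [hS']

/-- Every quantum double code is one on a finite complex for which the holonomy checks along all
non-contractible loops are logical operators. -/
theorem exists_saturated [Finite V] [Fintype E] [DecidableEq E] [Fintype G] (S : TwoComplex V E F)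
    (Y : Set V) :
    ∃ (V' : Type u) (F' : Type w) (_ : Finite V') (_ : Finite F')
      (S' : TwoComplex V' E F') (Y' : Set V'),
      S'.doubleCode G Y' = S.doubleCode G Y ∧ (Y = ∅ → Y' = ∅) ∧
      ∀ (a : Quot fun a b : V' => a ∈ Y' ∧ b ∈ Y')
        (γ : (S'.collapse Y').toDirGraph.Walk a a), (S'.collapse Y').NonContractible γ →
          IsZLogical (S'.doubleCode G Y') γ.word ⊥ := by
  classical
  let W := Quot fun a b : V => a ∈ Y ∧ b ∈ Y
  let Γ : DirGraph W E := S.toDirGraph.mapVert (Quot.mk _)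
  -- All flat configurations are bundled into one, with values in a finite group.
  let h : E → {g : E → G // S.IsFlat g} → G := fun e g => g.1 e
  have hh : ∀ (x : Word E) g, x.eval h g = x.eval g.1 := fun x g => Word.eval_pi x h g
  let r : ∀ a b (k : {g : E → G // S.IsFlat g} → G),
      (∃ p : Γ.Walk a b, p.word.eval h = k) → Γ.Walk a b := fun a b k hp => hp.choose
  have hr : ∀ a b k hp, (r a b k hp).word.eval h = k := fun a b k hp => hp.choose_spec
  -- There is one 2-cell per start vertex, edge and holonomy value for which the representatives
  -- exist; it forces the representative followed by the edge to be homotopic to the next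
  -- representative.
  let J := {j : W × E × ({g : E → G // S.IsFlat g} → G) //
    (∃ p : Γ.Walk j.1 (Γ.src j.2.1), p.word.eval h = j.2.2) ∧
      ∃ p : Γ.Walk j.1 (Γ.tgt j.2.1), p.word.eval h = j.2.2 * h j.2.1}
  let w : ∀ j : J, Γ.Walk j.1.1 j.1.1 := fun j =>
    (r _ _ _ j.2.1).append (.fwd _ (r _ _ _ j.2.2).reverse)
  have hw : ∀ j, (w j).word.eval h = 1 := fun j => by
    rw [Walk.word_append, Word.eval_append, Walk.word, Word.eval_cons_true, Walk.eval_reverse, hr,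
      hr]
    group
  let ε : ULift.{w} (Fin (Nat.card J)) ≃ J := Equiv.ulift.trans (Finite.equivFin J).symm
  let S' : TwoComplex W E (ULift.{w} (Fin (Nat.card J))) :=
    { toDirGraph := Γ
      base := fun f => (ε f).1.1
      bdry := fun f => w (ε f) }
  have hnull : ∀ j, S'.homotopyClass (w j) = .refl _ := fun j => by
    obtain ⟨f, rfl⟩ := ε.surjective j
    exact homotopyClass_bdry (S := S') f
  have hS' : ∀ {a : W} (γ : S'.toDirGraph.Walk a a), γ.word.eval h = 1 → ¬ S'.NonContractible γ :=
    fun γ hγ => not_nonContractible_of_eval_eq_one h r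
      (fun a e k h₁ h₂ => hnull ⟨(a, e, k), h₁, h₂⟩) hγ
  -- The old boundaries have trivial `h`-holonomy, hence are null-homotopic in `S'` and trivial for
  -- every `S'`-flat `g`. The new boundaries have trivial `h`-holonomy by construction.
  have hflat : ∀ g : E → G, S'.IsFlat g ↔ S.IsFlat g := by
    refine fun g => ⟨fun hg f => ?_, fun hg f => ?_⟩
    · have h1 := S'.eval_eq_one_of_not_nonContractible hg
        (hS' ((S.bdry f).mapVert (Quot.mk _)) (funext fun g' => by
          rw [hh, Walk.word_mapVert]
          exact g'.2 f))
      rwa [Walk.word_mapVert] at h1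
    · exact (hh _ ⟨g, hg⟩).symm.trans (congrFun (hw (ε f)) _)
  refine ⟨W, _, inferInstance, inferInstance, S', Quot.mk _ '' Y,
    doubleCode_eq_of_isFlat_iff rfl hflat, fun hY => by subst hY; exact Set.image_empty _, fun a γ hγ => ?_⟩
  -- The image of `Y` has at most one point, so the second collapse identifies nothing and loops
  -- lift back to `S'`.
  have hinj : Function.Injective
      (Quot.mk fun a b : W => a ∈ Quot.mk _ '' Y ∧ b ∈ Quot.mk _ '' Y) := by
    intro a b hab
    rcases quot_mk_eq_iff.1 hab with hab | ⟨⟨a, ha, rfl⟩, ⟨b, hb, rfl⟩⟩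
    · exact hab
    · exact Quot.sound ⟨ha, hb⟩
  obtain ⟨a, rfl⟩ := Quot.exists_rep a
  obtain ⟨b, q, hb, hq⟩ := Walk.exists_mapVert_eq hinj γ a rfl
  obtain rfl := hinj hb
  obtain rfl := eq_of_heq hq
  have h1 : q.word.eval h ≠ 1 := fun h1 => not_nonContractible_collapse (hS' q h1) hγ
  obtain ⟨g, hg⟩ := Function.ne_iff.1 h1
  refine isZLogical_of_eval_ne_one _ ((hflat g.1).2 g.2) ?_
  rwa [hh, ← Walk.word_mapVert] at hg

end TwoComplex

end QDouble

/-- First part: every quantum double code has, on the same qudits, the same code space as one on a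
finite complex for which every non-contractible loop of `Σ'/Y'` supports a `Z`-logical operator,
namely the check that the holonomy around this very loop is trivial. Second part: whenever every
non-contractible loop of `Σ/Y` supports a `Z`-logical operator, `d_Z` is the length of the shortest
such loop. -/
theorem mainTheorem8 (G : Type z) [Group G] [Fintype G] :
    (∀ (V : Type u) (E : Type v) (F : Type w) [Finite V] [Fintype E] [DecidableEq E]
        (S : QDouble.TwoComplex V E F) (Y : Set V),
      ∃ (V' : Type u) (F' : Type w) (_ : Finite V') (_ : Finite F')
        (S' : QDouble.TwoComplex V' E F') (Y' : Set V'),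
        S'.doubleCode G Y' = S.doubleCode G Y ∧ (Y = ∅ → Y' = ∅) ∧
        ∀ (a : Quot fun a b : V' => a ∈ Y' ∧ b ∈ Y')
          (γ : (S'.collapse Y').toDirGraph.Walk a a), (S'.collapse Y').NonContractible γ →
            S'.SupportsZLogical G Y' γ ∧ QDouble.IsZLogical (S'.doubleCode G Y') γ.word ⊥) ∧
    (∀ (V : Type u) (E : Type v) (F : Type w) [Finite V] [Fintype E] [DecidableEq E]
        (S : QDouble.TwoComplex V E F) (Y : Set V),
      (∀ (a : Quot fun a b : V => a ∈ Y ∧ b ∈ Y)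
          (γ : (S.collapse Y).toDirGraph.Walk a a), (S.collapse Y).NonContractible γ →
            S.SupportsZLogical G Y γ) →
        QDouble.dZ (S.doubleCode G Y) = (S.collapse Y).systole) := by
  refine ⟨fun V E F _ _ _ S Y => ?_, fun V E F _ _ _ S Y h => QDouble.TwoComplex.dZ_eq_systole h⟩
  obtain ⟨V', F', hV, hF, S', Y', hC, hY, h⟩ := QDouble.TwoComplex.exists_saturated (G := G) S Y
  exact ⟨V', F', hV, hF, S', Y', hC, hY, fun a γ hγ =>
    ⟨⟨γ.word, ⊥, Finset.Subset.refl _, h a γ hγ⟩, h a γ hγ⟩⟩
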